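/- Let $A=(a_{ij})\in\mathbb{R}^{n\times n}$ and let its induced graph $G$ have nodes $1,\dots,n$ and an edge between distinct $i,j$ whenever $a_{ij}\neq 0$ or $a_{ji}\neq 0$; let $N_i$ be the set of neighbours of $i$. Let $D=\mathrm{diag}\{d_i\}$ with all $d_i>0$, put $$\varrho_i=\frac{\sum_{j\neq i}|a_{ij}|d_j}{a_{ii}d_i},$$ and suppose that $A$ is weakly $D$-scaled diagonally dominant: $a_{ii}>0$ for every $i$ and $\varrho_i\varrho_j<1$ for every edge $(i,j)$ of $G$. For $b\in\mathbb{R}^n$, the message-passing algorithm for $Ax=b$ starts from $a_{i\to j}^{(0)}=a_{ii}$, $b_{i\to j}^{(0)}=b_i$ ($j\in N_i$) and computes, for $k\ge 1$, $$a_i^{(k)}=a_{ii}-\sum_{v\in N_i}\frac{a_{vi}a_{iv}}{a_{v\to i}^{(k-1)}},\quad b_i^{(k)}=b_i-\sum_{v\in N_i}\frac{a_{iv}b_{v\to i}^{(k-1)}}{a_{v\to i}^{(k-1)}},\quad x_i^{(k)}=\frac{b_i^{(k)}}{a_i^{(k)}},$$ $$a_{i\to j}^{(k)}=a_i^{(k)}+\frac{a_{ji}a_{ij}}{a_{j\to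 i}^{(k-1)}},\quad b_{i\to j}^{(k)}=b_i^{(k)}+\frac{a_{ij}b_{j\to i}^{(k-1)}}{a_{j\to i}^{(k-1)}}\qquad(j\in N_i).$$ With $x^\star=A^{-1}b$, a norm $\|\cdot\|$ on $\mathbb{R}^n$ and a constant $C>0$, its asymptotic convergence rate is $$\lambda_\infty=\inf\Big\{\lambda>0:\ \lim_{k\to\infty}\frac{\|x^{(k)}-x^\star\|}{\lambda^k}\ \text{exists and is}\ \le C\|x^\star\|\Big\}$$ (and $+\infty$ if there is no such $\lambda$). A simple loop is a path $p=(i_0,i_1,\dots,i_k)$ in $G$ with $k\ge1$, $i_k=i_0$, $i_{\ell+2}\neq i_\ell$ for $0\le\ell\le k-2$, and $i_\ell\neq i_0$ for $0<\ell<k$ (other nodes may be repeated). Its loop gain per node is $\lambda(p)=(\varrho_{i_0}\varrho_{i_1}\cdots\varrho_{i_{k-1}})^{1/k}$, and $\lambda_\star=\max\{\lambda(p): p\text{ a simple loop in }G\}$, with $\lambda_\star=0$ if there are no simple loops. Then $A$ is invertible, no division by zero occurs in the algorithm, the maximum defining $\lambda_\star$ is attained whenever there is a simple loop, and for every $b$,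 every norm and every constant $C>0$, $$\lambda_\infty\le\lambda_\star<1.$$ -/

import Mathlib

/-- The induced graph of `A`: distinct nodes `i`, `j` are adjacent iff `A i j ≠ 0` or `A j i ≠ 0`. -/
def inducedGraph {n : ℕ} (A : Matrix (Fin n) (Fin n) ℝ) : SimpleGraph (Fin n) :=
  SimpleGraph.fromRel (fun i j => A i j ≠ 0)

open Classical in
/-- The neighbouring set `N_i` of node `i` in the induced graph. -/
noncomputable def nbr {n : ℕ} (A : Matrix (Fin n) (Fin n) ℝ) (i : Fin n) : Finset (Fin n) :=
  Finset.univ.filter (fun v => (inducedGraph A).Adj i v)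

/-- The scaled row ratio `ϱ_i = (∑_{j ≠ i} |a_ij| d_j) / (a_ii d_i)`. -/
noncomputable def rowRatio {n : ℕ} (A : Matrix (Fin n) (Fin n) ℝ) (d : Fin n → ℝ) (i : Fin n) : ℝ :=
  (∑ j ∈ Finset.univ.erase i, |A i j| * d j) / (A i i * d i)

/-- `A` is weakly `D`-scaled diagonally dominant, `D = diag d`
(the positivity of `d` is stated separately). -/
def WeaklyScaledDiagDominant {n : ℕ} (A : Matrix (Fin n) (Fin n) ℝ) (d : Fin n → ℝ) : Prop :=
  (∀ i, 0 < A i i) ∧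
    ∀ i j, (inducedGraph A).Adj i j → rowRatio A d i * rowRatio A d j < 1

/-! ### The message-passing algorithm -/

/-- The node quantity `a_i` computed from the incoming messages `μ v i = a_{v→i}` of the
previous iteration. -/
noncomputable def nodeAStep {n : ℕ} (A : Matrix (Fin n) (Fin n) ℝ) (μ : Fin n → Fin n → ℝ)
    (i : Fin n) : ℝ :=
  A i i - ∑ v ∈ nbr A i, A v i * A i v / μ v i

/-- The node quantity `b_i` computed from the incoming messages `μ v i = a_{v→i}` and
`β v i = b_{v→i}` of the previous iteration. -/
noncomputable def nodeBStep {n : ℕ} (A : Matrix (Fin n) (Fin n) ℝ) (b : Fin n → ℝ)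
    (μ β : Fin n → Fin n → ℝ) (i : Fin n) : ℝ :=
  b i - ∑ v ∈ nbr A i, A i v * β v i / μ v i

/-- `msgA A k i j` is the message `a_{i→j}^{(k)}` (meaningful for `j ∈ N_i`). -/
noncomputable def msgA {n : ℕ} (A : Matrix (Fin n) (Fin n) ℝ) : ℕ → Fin n → Fin n → ℝ
  | 0 => fun i _ => A i i
  | k + 1 => fun i j => nodeAStep A (msgA A k) i + A j i * A i j / msgA A k j i

/-- `msgB A b k i j` is the message `b_{i→j}^{(k)}` (meaningful for `j ∈ N_i`). -/
noncomputable def msgB {n : ℕ} (A : Matrix (Fin n) (Fin n) ℝ) (b : Fin n → ℝ) :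
    ℕ → Fin n → Fin n → ℝ
  | 0 => fun i _ => b i
  | k + 1 => fun i j =>
      nodeBStep A b (msgA A k) (msgB A b k) i + A i j * msgB A b k j i / msgA A k j i

/-- The estimate vector `x^{(k)}`, `x_i^{(k)} = b_i^{(k)} / a_i^{(k)}`, for `k ≥ 1`.
There is no estimate before the first iteration; the value at `k = 0` is a placeholder, which
does not influence any limit as `k → ∞`. -/
noncomputable def estimate {n : ℕ} (A : Matrix (Fin n) (Fin n) ℝ) (b : Fin n → ℝ) :
    ℕ → Fin n → ℝ
  | 0 => fun _ => 0
  | k + 1 => fun i => nodeBStep A b (msgA A k) (msgB A b k) i / nodeAStep A (msgA A k) i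

/-- No division by zero occurs in the algorithm: all the messages `a_{i→j}^{(k)}`, `k ≥ 0`,
`j ∈ N_i`, and all the node quantities `a_i^{(k)}`, `k ≥ 1`, are nonzero. -/
def AlgorithmWellDefined {n : ℕ} (A : Matrix (Fin n) (Fin n) ℝ) : Prop :=
  (∀ k i j, (inducedGraph A).Adj i j → msgA A k i j ≠ 0) ∧
    ∀ k i, nodeAStep A (msgA A k) i ≠ 0

/-- The exact solution `x⋆ = A⁻¹ b`. -/
noncomputable def exactSolution {n : ℕ} (A : Matrix (Fin n) (Fin n) ℝ) (b : Fin n → ℝ) :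
    Fin n → ℝ :=
  A⁻¹.mulVec b

/-- The asymptotic convergence rate, with respect to the norm `N` and the constant `C`: the
infimum of all `r > 0` for which `lim_k N (x^{(k)} - x⋆) / r ^ k` exists and is at most
`C * N x⋆`. It is `⊤` if there is no such `r`. -/
noncomputable def asymptoticRate {n : ℕ} (A : Matrix (Fin n) (Fin n) ℝ) (b : Fin n → ℝ)
    (N : Seminorm ℝ (Fin n → ℝ)) (C : ℝ) : EReal :=
  sInf {s : EReal | ∃ r : ℝ, s = (r : EReal) ∧ 0 < r ∧ ∃ L : ℝ,
    Filter.Tendsto (fun k : ℕ => N (estimate A b k - exactSolution A b) / r ^ k)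
      Filter.atTop (nhds L) ∧ L ≤ C * N (exactSolution A b)}

/-! ### Simple loops and their gains -/

/-- A path `i_0, …, i_k` is non-reversal if `i_{ℓ+2} ≠ i_ℓ` for `ℓ = 0, …, k-2`. -/
def NonReversal {V : Type*} {G : SimpleGraph V} {u v : V} (p : G.Walk u v) : Prop :=
  ∀ l : ℕ, l + 2 ≤ p.length → p.getVert (l + 2) ≠ p.getVert l

/-- A simple loop at `i`: a non-reversal path of positive length from `i` to `i` which does not
visit `i` in between. (Other nodes may be visited more than once.) -/
def IsSimpleLoop {V : Type*} {G : SimpleGraph V} {i : V} (p : G.Walk i i) : Prop :=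
  0 < p.length ∧ NonReversal p ∧ ∀ l : ℕ, 0 < l → l < p.length → p.getVert l ≠ i

/-- The gain `ϱ_{i_0} ϱ_{i_1} ⋯ ϱ_{i_{k-1}}` of a path `i_0, …, i_k`. -/
noncomputable def pathGain {n : ℕ} (A : Matrix (Fin n) (Fin n) ℝ) (d : Fin n → ℝ) {u v : Fin n}
    (p : (inducedGraph A).Walk u v) : ℝ :=
  ∏ l ∈ Finset.range p.length, rowRatio A d (p.getVert l)

/-- The set of the loop gains per node `(g p) ^ (1 / k)` of all simple loops `p`, where `k` is
the length of `p`. -/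
def loopGains {n : ℕ} (A : Matrix (Fin n) (Fin n) ℝ) (d : Fin n → ℝ) : Set ℝ :=
  {x | ∃ (i : Fin n) (p : (inducedGraph A).Walk i i),
    IsSimpleLoop p ∧ x = pathGain A d p ^ (1 / (p.length : ℝ))}

/-- The maximum loop gain per node `λ⋆`; it is `0` if there is no simple loop. -/
noncomputable def maxLoopGain {n : ℕ} (A : Matrix (Fin n) (Fin n) ℝ) (d : Fin n → ℝ) : ℝ :=
  sSup (loopGains A d)

/-! The algorithm is Gaussian elimination on the computation tree of `G`. Fix an estimate at a root
and assign values to the other tree nodes by back substitution: their errors relative to the exact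
solution satisfy the homogeneous row equations of `A`, except that neighbours missing beyond the
leaves have value `0`, hence error `-x v` (`back_substitution`). By `exists_nbr_le`, the scaled
error at a node is at most `ϱ` times that at some neighbour. If that neighbour is in turn bounded
through the node it came from, `ϱ_i ϱ_j < 1` forces the error to vanish; otherwise the bounds run
down the tree along a non-reversal walk. So each error is zero or at most a constant times the gain
of such a walk (`message_error_le`, `estimate_error_le`).

Cutting a walk at the last visit to its starting vertex, and repeating, splits it into closed
non-reversal walks, which are chains of simple loops, and at most `n` single vertices. Its gain is
therefore at most a constant times a power of any positive bound on the loop gains per node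
(`nonrev_gain_le`), which gives the rate.

There may be infinitely many simple loops, but one longer than `n ^ 2` repeats a directed edge and
can be cut there, so short loops decide the maximum (`loop_gain_le`). Positivity of the messages
comes from a second scaling in which `A` is strictly dominant (`exists_strict_scaling`,
`msgA_bound`). -/

/-! ### Non-reversal sequences of vertices -/

/-- The first `k + 1` entries of `w` form a non-reversal walk in `G`. -/
def IsNonrevSeq {V : Type*} (G : SimpleGraph V) (w : ℕ → V) (k : ℕ) : Prop :=
  (∀ l < k, G.Adj (w l) (w (l + 1))) ∧ ∀ l, l + 2 ≤ k → w (l + 2) ≠ w l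

/-- The first `k + 1` entries of `w` form a simple loop in `G`. -/
def IsLoopSeq {V : Type*} (G : SimpleGraph V) (w : ℕ → V) (k : ℕ) : Prop :=
  0 < k ∧ IsNonrevSeq G w k ∧ w k = w 0 ∧ ∀ l, 0 < l → l < k → w l ≠ w 0

section Sequences

variable {V : Type*} {G : SimpleGraph V}

theorem IsNonrevSeq.shift {w : ℕ → V} {a k m : ℕ} (h : IsNonrevSeq G w m) (hm : a + k ≤ m) :
    IsNonrevSeq G (fun l => w (a + l)) k :=
  ⟨fun l hl => h.1 (a + l) (by omega), fun l hl => h.2 (a + l) (by omega)⟩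

theorem IsNonrevSeq.mono {w : ℕ → V} {k m : ℕ} (h : IsNonrevSeq G w m) (hm : k ≤ m) :
    IsNonrevSeq G w k :=
  ⟨fun l hl => h.1 l (by omega), fun l hl => h.2 l (by omega)⟩

/-- A closed non-reversal walk is a concatenation of simple loops. -/
theorem closed_gain_le {ρ : V → ℝ} (hρ : ∀ v, 0 ≤ ρ v) {r : ℝ} (hr : 0 ≤ r) {K : ℕ}
    (hloop : ∀ w k, k ≤ K → IsLoopSeq G w k → ∏ l ∈ Finset.range k, ρ (w l) ≤ r ^ k) (k : ℕ) :
    ∀ w : ℕ → V, k ≤ K → IsNonrevSeq G w k → w k = w 0 →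
      ∏ l ∈ Finset.range k, ρ (w l) ≤ r ^ k := by
  classical
  induction k using Nat.strong_induction_on with
  | _ k ih =>
    intro w hk hw hc
    rcases Nat.eq_zero_or_pos k with rfl | hpos
    · simp
    -- The first return closes a simple loop; what follows is again closed at `w 0`.
    have hex : ∃ m, 0 < m ∧ w m = w 0 := ⟨k, hpos, hc⟩
    obtain ⟨hm0, hm⟩ := Nat.find_spec hex
    have hmin : ∀ l, 0 < l → l < Nat.find hex → w l ≠ w 0 := fun l h0 hl h =>
      Nat.find_min hex hl ⟨h0, h⟩
    have hmk : Nat.find hex ≤ k := Nat.find_min' hex ⟨hpos, hc⟩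
    generalize Nat.find hex = m at *
    obtain ⟨q, rfl⟩ := Nat.exists_eq_add_of_le hmk
    rw [Finset.prod_range_add, pow_add]
    refine mul_le_mul (hloop w m (by omega) ⟨hm0, hw.mono hmk, hm, hmin⟩)
      (ih q (by omega) (fun l => w (m + l)) (by omega) (hw.shift le_rfl) ?_)
      (Finset.prod_nonneg fun _ _ => hρ _) (pow_nonneg hr _)
    simp only [add_zero]
    rw [hc, hm]

/-- The gain of a non-reversal walk whose simple loops all have gain at most `r` per node. -/
theorem nonrev_gain_le [DecidableEq V] {ρ : V → ℝ} (hρ : ∀ v, 0 ≤ ρ v) {r M : ℝ} (hr : 0 ≤ r)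
    (hM : 1 ≤ M) (hρM : ∀ v, ρ v ≤ M * r)
    (hloop : ∀ w k, IsLoopSeq G w k → ∏ l ∈ Finset.range k, ρ (w l) ≤ r ^ k) (S : Finset V) :
    ∀ (w : ℕ → V) (k : ℕ), IsNonrevSeq G w k → (∀ l ≤ k, w l ∈ S) →
      ∏ l ∈ Finset.range (k + 1), ρ (w l) ≤ M ^ S.card * r ^ (k + 1) := by
  induction S using Finset.strongInduction with
  | _ S ih =>
    intro w k hw hS
    have hM0 : (0 : ℝ) ≤ M := by linarith
    -- Cut at the last visit to `w 0`: the tail then lives in `S.erase (w 0)`, and the visit itself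
    -- costs one factor `M * r`.
    have hm : w (Nat.findGreatest (fun l => w l = w 0) k) = w 0 :=
      Nat.findGreatest_spec (P := fun l => w l = w 0) (Nat.zero_le k) rfl
    have hmk : Nat.findGreatest (fun l => w l = w 0) k ≤ k := Nat.findGreatest_le k
    have hlast : ∀ l, Nat.findGreatest (fun l => w l = w 0) k < l → l ≤ k → w l ≠ w 0 :=
      fun l h1 h2 => Nat.findGreatest_is_greatest h1 h2
    generalize Nat.findGreatest (fun l => w l = w 0) k = m at *
    have h0 : w 0 ∈ S := hS 0 (Nat.zero_le k)
    have hcard : (S.erase (w 0)).card + 1 = S.card := Finset.card_erase_add_one h0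
    have hhead : ∏ l ∈ Finset.range (m + 1), ρ (w l) ≤ r ^ m * (M * r) := by
      rw [Finset.prod_range_succ]
      exact mul_le_mul (closed_gain_le hρ hr (K := m) (fun w k _ h => hloop w k h) m w le_rfl
        (hw.mono hmk) hm) (hρM _) (hρ _) (pow_nonneg hr _)
    rcases hmk.eq_or_lt with rfl | hlt
    · refine hhead.trans ?_
      have : M ≤ M ^ S.card := le_self_pow₀ hM (by omega)
      calc r ^ m * (M * r) = M * r ^ (m + 1) := by ring
        _ ≤ _ := mul_le_mul_of_nonneg_right this (pow_nonneg hr _)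
    · obtain ⟨q, rfl⟩ := Nat.exists_eq_add_of_lt hlt
      have htail := ih (S.erase (w 0)) (Finset.erase_ssubset h0) (fun l => w (m + 1 + l)) q
        (hw.shift (by omega)) fun l hl =>
          Finset.mem_erase.2 ⟨hlast _ (by omega) (by omega), hS _ (by omega)⟩
      rw [show m + q + 1 + 1 = (m + 1) + (q + 1) by omega, Finset.prod_range_add]
      refine (mul_le_mul hhead htail (Finset.prod_nonneg fun _ _ => hρ _) (by positivity)).trans
        (le_of_eq ?_)
      rw [← hcard]
      ring

/-- Cutting out the part between two passages through the same directed edge. -/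
theorem IsLoopSeq.splice {w : ℕ → V} {a c q : ℕ} (hc : 0 < c) (hq : 0 < q)
    (h : IsLoopSeq G w (a + c + q)) (h0 : w a = w (a + c)) (h1 : w (a + 1) = w (a + c + 1)) :
    IsLoopSeq G (fun l => if l ≤ a then w l else w (c + l)) (a + q) := by
  obtain ⟨-, ⟨hadj, hrev⟩, hcl, hne⟩ := h
  refine ⟨by omega, ⟨fun l hl => ?_, fun l hl => ?_⟩, ?_, fun l hl0 hl => ?_⟩
  · rcases lt_trichotomy l a with hla | rfl | hla
    · simpa [hla.le, Nat.succ_le_of_lt hla] using hadj l (by omega)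
    · simp only [le_refl, if_true, show ¬ l + 1 ≤ l by omega, if_false, h0]
      rw [show c + (l + 1) = l + c + 1 by omega]
      exact hadj (l + c) (by omega)
    · simp only [show ¬ l ≤ a by omega, show ¬ l + 1 ≤ a by omega, if_false]
      exact hadj (c + l) (by omega)
  · rcases lt_trichotomy (l + 1) a with hla | hla | hla
    · simp only [show l ≤ a by omega, show l + 2 ≤ a by omega, if_true]
      exact hrev l (by omega)
    -- At the junction the new successor is `w (a + c + 1) = w (a + 1)`; this is why a directed
    -- edge, not just a vertex, must repeat.
    · subst hla
      simp only [show l ≤ l + 1 by omega, show ¬ l + 2 ≤ l + 1 by omega, if_true, if_false]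
      have := hrev l (by omega)
      rw [show l + 2 = l + 1 + 1 by omega, h1] at this
      rwa [show c + (l + 2) = l + 1 + c + 1 by omega]
    · rcases (show a ≤ l by omega).eq_or_lt with rfl | hl'
      · simp only [le_refl, show ¬ a + 2 ≤ a by omega, if_true, if_false, h0]
        have := hrev (a + c) (by omega)
        rwa [show c + (a + 2) = a + c + 2 by omega]
      · simp only [show ¬ l ≤ a by omega, show ¬ l + 2 ≤ a by omega, if_false]
        exact hrev (c + l) (by omega)
  · simp only [show ¬ a + q ≤ a by omega, if_false, Nat.zero_le, if_true]
    rw [← hcl]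
    congr 1
    omega
  · simp only [Nat.zero_le, if_true]
    split_ifs with hla
    · exact hne l hl0 (by omega)
    · exact hne (c + l) (by omega) (by omega)

/-- A bound on the gains of the short simple loops is a bound on those of all simple loops, and
if there is a simple loop at all, then there is a short one. -/
theorem loop_gain_le [Fintype V] {ρ : V → ℝ} (hρ : ∀ v, 0 ≤ ρ v) {r : ℝ} (hr : 0 ≤ r)
    (hloop : ∀ w k, k ≤ Fintype.card (V × V) → IsLoopSeq G w k →
      ∏ l ∈ Finset.range k, ρ (w l) ≤ r ^ k) (k : ℕ) :
    ∀ w : ℕ → V, IsLoopSeq G w k → ∏ l ∈ Finset.range k, ρ (w l) ≤ r ^ k ∧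
      ∃ w' k', k' ≤ Fintype.card (V × V) ∧ IsLoopSeq G w' k' := by
  induction k using Nat.strong_induction_on with
  | _ k ih =>
    intro w hw
    rcases le_or_gt k (Fintype.card (V × V)) with hk | hk
    · exact ⟨hloop w k hk hw, w, k, hk, hw⟩
    obtain ⟨a, m, ham, hmk, heq⟩ : ∃ a m, a < m ∧ m < k ∧
        (w a, w (a + 1)) = (w m, w (m + 1)) := by
      obtain ⟨x, y, hxy, h⟩ := Fintype.exists_ne_map_eq_of_card_lt
        (fun l : Fin k => (w l, w (l + 1))) (by simpa using hk)
      rcases lt_or_gt_of_ne hxy with hlt | hlt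
      · exact ⟨x, y, hlt, y.2, h⟩
      · exact ⟨y, x, hlt, x.2, h.symm⟩
    obtain ⟨c, rfl⟩ := Nat.exists_eq_add_of_lt ham
    obtain ⟨q, rfl⟩ := Nat.exists_eq_add_of_lt hmk
    obtain ⟨h0, h1⟩ := Prod.mk.inj heq
    rw [show a + c + 1 + q + 1 = a + (c + 1) + (q + 1) by omega] at *
    have hout := hw.splice (Nat.succ_pos c) (Nat.succ_pos q) h0 h1
    obtain ⟨hg, hex⟩ := ih _ (by omega) _ hout
    refine ⟨?_, hex⟩
    -- The excised segment is closed but need not be simple. Its simple loops have length at most `c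
    -- + 1`, so the induction hypothesis covers them.
    have hin := closed_gain_le hρ hr (K := c + 1) (fun w' k' hk' h => (ih k' (by omega) w' h).1)
      (c + 1) (fun l => w (a + l)) le_rfl (hw.2.1.shift (by omega)) h0.symm
    have hsplit : ∏ l ∈ Finset.range (a + (q + 1)), ρ (if l ≤ a then w l else w (c + 1 + l)) =
        (∏ l ∈ Finset.range a, ρ (w l)) *
          ∏ l ∈ Finset.range (q + 1), ρ (w (a + (c + 1) + l)) := by
      rw [Finset.prod_range_add]
      congr 1
      · refine Finset.prod_congr rfl fun l hl => ?_
        rw [if_pos (Finset.mem_range.1 hl).le]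
      · refine Finset.prod_congr rfl fun l _ => ?_
        rcases Nat.eq_zero_or_pos l with rfl | hl
        · simp only [add_zero, le_refl, if_true]
          rw [h0]
          rfl
        · rw [if_neg (by omega)]
          congr 2
          omega
    simp only [hsplit] at hg
    rw [Finset.prod_range_add, Finset.prod_range_add]
    calc _ = ((∏ l ∈ Finset.range a, ρ (w l)) *
          ∏ l ∈ Finset.range (q + 1), ρ (w (a + (c + 1) + l))) *
          ∏ l ∈ Finset.range (c + 1), ρ (w (a + l)) := by ring
      _ ≤ r ^ (a + (q + 1)) * r ^ (c + 1) :=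
        mul_le_mul hg hin (Finset.prod_nonneg fun _ _ => hρ _) (pow_nonneg hr _)
      _ = _ := by ring

/-- The walk through the first `k + 1` entries of a sequence of successively adjacent vertices. -/
theorem exists_walk_of_seq (w : ℕ → V) (k : ℕ) (h : ∀ l < k, G.Adj (w l) (w (l + 1))) :
    ∃ p : G.Walk (w 0) (w k), p.length = k ∧ ∀ l ≤ k, p.getVert l = w l := by
  induction k generalizing w with
  | zero => exact ⟨.nil, rfl, fun l hl => by simp [Nat.le_zero.1 hl]⟩
  | succ k ih =>
    obtain ⟨p, hp, hv⟩ := ih (fun l => w (l + 1)) fun l hl => h (l + 1) (by omega)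
    refine ⟨.cons (h 0 (Nat.succ_pos k)) p, by simp [hp], fun l hl => ?_⟩
    cases l with
    | zero => simp
    | succ l => simpa using hv l (by omega)

/-- Cutting and splicing is done on sequences, which carry no endpoints in their type; this and the
next result translate back and forth. -/
theorem IsSimpleLoop.isLoopSeq {i : V} {p : G.Walk i i} (hp : IsSimpleLoop p) :
    IsLoopSeq G p.getVert p.length :=
  ⟨hp.1, ⟨fun _ hl => p.adj_getVert_succ hl, hp.2.1⟩, by simp, by simpa using hp.2.2⟩

theorem IsLoopSeq.exists_isSimpleLoop {w : ℕ → V} {k : ℕ} (h : IsLoopSeq G w k) :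
    ∃ (i : V) (p : G.Walk i i), IsSimpleLoop p ∧ p.length = k ∧ ∀ l ≤ k, p.getVert l = w l := by
  obtain ⟨hk, ⟨hadj, hrev⟩, hcl, hne⟩ := h
  obtain ⟨p, hp, hv⟩ := exists_walk_of_seq w k hadj
  refine ⟨w 0, p.copy rfl hcl, ⟨by simpa [hp] using hk, fun l hl => ?_, fun l h0 hl => ?_⟩,
    by simpa using hp, by simpa using hv⟩
  · simp only [SimpleGraph.Walk.length_copy, hp] at hl
    simp only [SimpleGraph.Walk.getVert_copy]
    rw [hv _ hl, hv _ (by omega)]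
    exact hrev l hl
  · simp only [SimpleGraph.Walk.length_copy, hp] at hl
    simp only [SimpleGraph.Walk.getVert_copy]
    rw [hv _ hl.le]
    exact hne l h0 hl

end Sequences

/-! ### The maximum loop gain -/

section LoopGains

variable {n : ℕ} {A : Matrix (Fin n) (Fin n) ℝ} {d : Fin n → ℝ}

theorem rowRatio_nonneg (hd : ∀ i, 0 < d i) (hA : WeaklyScaledDiagDominant A d) (i : Fin n) :
    0 ≤ rowRatio A d i :=
  div_nonneg (Finset.sum_nonneg fun j _ => mul_nonneg (abs_nonneg _) (hd j).le)
    (mul_pos (hA.1 i) (hd i)).le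

theorem loopGains_nonneg (hρ : ∀ i, 0 ≤ rowRatio A d i) {x : ℝ} (hx : x ∈ loopGains A d) :
    0 ≤ x := by
  obtain ⟨i, p, -, rfl⟩ := hx
  exact Real.rpow_nonneg (Finset.prod_nonneg fun _ _ => hρ _) _

theorem IsLoopSeq.rpow_mem_loopGains {w : ℕ → Fin n} {k : ℕ}
    (h : IsLoopSeq (inducedGraph A) w k) :
    (∏ l ∈ Finset.range k, rowRatio A d (w l)) ^ (1 / (k : ℝ)) ∈ loopGains A d := by
  obtain ⟨i, p, hp, rfl, hv⟩ := h.exists_isSimpleLoop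
  refine ⟨i, p, hp, ?_⟩
  unfold pathGain
  congr 1
  exact Finset.prod_congr rfl fun l hl => by rw [hv l (Finset.mem_range.1 hl).le]

theorem rpow_one_div_le_iff {g r : ℝ} (hg : 0 ≤ g) (hr : 0 ≤ r) {k : ℕ} (hk : 0 < k) :
    g ^ (1 / (k : ℝ)) ≤ r ↔ g ≤ r ^ k := by
  rw [one_div, Real.rpow_inv_le_iff_of_pos hg hr (by exact_mod_cast hk), Real.rpow_natCast]

/-- The loop gains per node of the simple loops attain their maximum. -/
theorem loopGains_isGreatest (hρ : ∀ i, 0 ≤ rowRatio A d i) (hne : (loopGains A d).Nonempty) :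
    IsGreatest (loopGains A d) (maxLoopGain A d) := by
  set N := Fintype.card (Fin n × Fin n)
  let F : Set ℝ := {x | ∃ w k, k ≤ N ∧ IsLoopSeq (inducedGraph A) w k ∧
    x = (∏ l ∈ Finset.range k, rowRatio A d (w l)) ^ (1 / (k : ℝ))}
  have hfin : F.Finite := by
    refine (Set.finite_range fun q : Fin (N + 1) × (Fin (N + 1) → Fin n) =>
      (∏ l ∈ Finset.range q.1, rowRatio A d (q.2 (Fin.ofNat (N + 1) l))) ^
        (1 / ((q.1 : ℕ) : ℝ))).subset ?_
    rintro x ⟨w, k, hk, -, rfl⟩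
    refine ⟨(⟨k, by omega⟩, fun l => w l), ?_⟩
    dsimp only
    congr 1
    refine Finset.prod_congr rfl fun l hl => ?_
    have := Finset.mem_range.1 hl
    rw [Fin.val_ofNat, Nat.mod_eq_of_lt (by omega)]
  have hFne : F.Nonempty := by
    obtain ⟨x, i, p, hp, -⟩ := hne
    obtain ⟨R, hR⟩ : ∃ R : ℝ, 1 ≤ R ∧ ∀ i, rowRatio A d i ≤ R := by
      have hsum : 0 ≤ ∑ i, rowRatio A d i := Finset.sum_nonneg fun i _ => hρ i
      refine ⟨1 + ∑ i, rowRatio A d i, by linarith, fun i => ?_⟩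
      linarith [Finset.single_le_sum (fun i _ => hρ i) (Finset.mem_univ i)]
    -- Only the existence of a short loop is wanted here, so any crude bound `R` on the ratios will
    -- do.
    obtain ⟨-, w, k, hk, hw⟩ := loop_gain_le hρ (r := R) (by linarith) (fun w k _ _ => by
      simpa using Finset.prod_le_prod (s := Finset.range k) (fun l _ => hρ (w l))
        (fun l _ => hR.2 (w l))) _ _ hp.isLoopSeq
    exact ⟨_, w, k, hk, hw, rfl⟩
  obtain ⟨x, hxF, hx⟩ := Set.exists_max_image F id hfin hFne
  have hxmem : x ∈ loopGains A d := by
    obtain ⟨w, k, -, hw, rfl⟩ := hxF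
    exact hw.rpow_mem_loopGains
  have hx0 := loopGains_nonneg hρ hxmem
  have hgr : IsGreatest (loopGains A d) x := by
    refine ⟨hxmem, ?_⟩
    rintro y ⟨i, p, hp, rfl⟩
    refine (rpow_one_div_le_iff (Finset.prod_nonneg fun _ _ => hρ _) hx0 hp.1).2 ?_
    refine (loop_gain_le hρ hx0 (fun w k hk hw => ?_) _ _ hp.isLoopSeq).1
    exact (rpow_one_div_le_iff (Finset.prod_nonneg fun _ _ => hρ _) hx0 hw.1).1
      (hx _ ⟨w, k, hk, hw, rfl⟩)
  rwa [maxLoopGain, hgr.csSup_eq]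

theorem maxLoopGain_nonneg (hρ : ∀ i, 0 ≤ rowRatio A d i) : 0 ≤ maxLoopGain A d :=
  Real.sSup_nonneg fun _ hx => loopGains_nonneg hρ hx

theorem IsLoopSeq.gain_le_pow_maxLoopGain (hρ : ∀ i, 0 ≤ rowRatio A d i) {w : ℕ → Fin n} {k : ℕ}
    (h : IsLoopSeq (inducedGraph A) w k) :
    ∏ l ∈ Finset.range k, rowRatio A d (w l) ≤ maxLoopGain A d ^ k :=
  (rpow_one_div_le_iff (Finset.prod_nonneg fun _ _ => hρ _) (maxLoopGain_nonneg hρ) h.1).1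
    ((loopGains_isGreatest hρ ⟨_, h.rpow_mem_loopGains⟩).2 h.rpow_mem_loopGains)

/-- Rotating a loop by one step preserves its gain, so the squared gain is a product of `ϱ_i ϱ_j`
over its edges. -/
theorem IsLoopSeq.gain_lt_one (hd : ∀ i, 0 < d i) (hA : WeaklyScaledDiagDominant A d)
    {w : ℕ → Fin n} {k : ℕ} (h : IsLoopSeq (inducedGraph A) w k) :
    ∏ l ∈ Finset.range k, rowRatio A d (w l) < 1 := by
  obtain ⟨hk, ⟨hadj, -⟩, hcl, -⟩ := h
  have hρ := rowRatio_nonneg hd hA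
  have hshift : ∏ l ∈ Finset.range k, rowRatio A d (w (l + 1)) =
      ∏ l ∈ Finset.range k, rowRatio A d (w l) := by
    obtain ⟨q, rfl⟩ := Nat.exists_eq_add_of_lt hk
    rw [zero_add] at *
    rw [Finset.prod_range_succ, Finset.prod_range_succ' _ q, hcl]
  have hsq : (∏ l ∈ Finset.range k, rowRatio A d (w l)) *
      ∏ l ∈ Finset.range k, rowRatio A d (w l) < 1 := by
    nth_rewrite 2 [← hshift]
    rw [← Finset.prod_mul_distrib]
    obtain ⟨q, rfl⟩ := Nat.exists_eq_add_of_lt hk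
    rw [zero_add] at *
    rw [Finset.prod_range_succ]
    have h1 : ∏ l ∈ Finset.range q, rowRatio A d (w l) * rowRatio A d (w (l + 1)) ≤ 1 :=
      Finset.prod_le_one (fun l _ => mul_nonneg (hρ _) (hρ _)) fun l hl =>
        (hA.2 _ _ (hadj l ((Finset.mem_range.1 hl).trans (Nat.lt_succ_self q)))).le
    have h2 := hA.2 _ _ (hadj q (Nat.lt_succ_self q))
    have h3 := mul_nonneg (hρ (w q)) (hρ (w (q + 1)))
    nlinarith
  have h0 : 0 ≤ ∏ l ∈ Finset.range k, rowRatio A d (w l) := Finset.prod_nonneg fun _ _ => hρ _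
  nlinarith

theorem maxLoopGain_lt_one (hd : ∀ i, 0 < d i) (hA : WeaklyScaledDiagDominant A d) :
    maxLoopGain A d < 1 := by
  have hρ := rowRatio_nonneg hd hA
  rcases (loopGains A d).eq_empty_or_nonempty with he | hne
  · simp [maxLoopGain, he]
  · obtain ⟨i, p, hp, h⟩ := (loopGains_isGreatest hρ hne).1
    rw [h]
    exact Real.rpow_lt_one (Finset.prod_nonneg fun _ _ => hρ _)
      (hp.isLoopSeq.gain_lt_one hd hA) (by have := hp.1; positivity)

end LoopGains

/-! ### Rows of weakly scaled diagonally dominant matrices -/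

section Rows

variable {n : ℕ} {A : Matrix (Fin n) (Fin n) ℝ} {d : Fin n → ℝ}

theorem mem_nbr {i v : Fin n} : v ∈ nbr A i ↔ (inducedGraph A).Adj i v := by
  simp [nbr]

theorem eq_zero_of_notMem_nbr {i v : Fin n} (hv : v ≠ i) (h : v ∉ nbr A i) : A i v = 0 := by
  by_contra h0
  exact h (mem_nbr.2 ((SimpleGraph.fromRel_adj _ _ _).2 ⟨hv.symm, Or.inl h0⟩))

theorem sum_erase_eq_sum_nbr (i : Fin n) (f : Fin n → ℝ) (hf : ∀ v, A i v = 0 → f v = 0) :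
    ∑ v ∈ Finset.univ.erase i, f v = ∑ v ∈ nbr A i, f v := by
  symm
  refine Finset.sum_subset (fun v hv => ?_) fun v hv hv' =>
    hf v (eq_zero_of_notMem_nbr (Finset.ne_of_mem_erase hv) hv')
  exact Finset.mem_erase.2 ⟨(mem_nbr.1 hv).ne', Finset.mem_univ v⟩

theorem rowRatio_eq (i : Fin n) :
    rowRatio A d i = (∑ v ∈ nbr A i, |A i v| * d v) / (A i i * d i) := by
  rw [rowRatio, sum_erase_eq_sum_nbr (A := A) i (fun v => |A i v| * d v) fun v hv => by simp [hv]]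

theorem mulVec_eq_sum_nbr (x : Fin n → ℝ) (i : Fin n) :
    A.mulVec x i = A i i * x i + ∑ v ∈ nbr A i, A i v * x v := by
  rw [← sum_erase_eq_sum_nbr i (fun v => A i v * x v) fun v hv => by simp [hv],
    Finset.add_sum_erase _ (fun v => A i v * x v) (Finset.mem_univ i)]
  rfl

/-- A homogeneous row equation bounds the scaled value at a node by that at some neighbour. -/
theorem exists_nbr_le (hd : ∀ i, 0 < d i) {i : Fin n} (hi : 0 < A i i)
    (hne : (nbr A i).Nonempty) {e : ℝ} {f : Fin n → ℝ}
    (h : A i i * e + ∑ v ∈ nbr A i, A i v * f v = 0) :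
    ∃ v ∈ nbr A i, |e| / d i ≤ rowRatio A d i * (|f v| / d v) := by
  obtain ⟨v, hv, hmax⟩ := Finset.exists_max_image (nbr A i) (fun v => |f v| / d v) hne
  refine ⟨v, hv, ?_⟩
  have h1 : A i i * |e| ≤ (∑ u ∈ nbr A i, |A i u| * d u) * (|f v| / d v) := by
    calc A i i * |e| = |A i i * e| := by rw [abs_mul, abs_of_pos hi]
      _ = |∑ u ∈ nbr A i, A i u * f u| := by
        rw [eq_neg_of_add_eq_zero_left h, abs_neg]
      _ ≤ ∑ u ∈ nbr A i, |A i u * f u| := Finset.abs_sum_le_sum_abs _ _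
      _ ≤ ∑ u ∈ nbr A i, |A i u| * d u * (|f v| / d v) := by
        refine Finset.sum_le_sum fun u hu => ?_
        rw [abs_mul, mul_assoc]
        refine mul_le_mul_of_nonneg_left ?_ (abs_nonneg _)
        have := (div_le_iff₀ (hd u)).1 (hmax u hu)
        linarith
      _ = _ := by rw [Finset.sum_mul]
  rw [rowRatio_eq, div_mul_eq_mul_div, div_le_div_iff₀ (hd i) (mul_pos hi (hd i))]
  nlinarith [mul_le_mul_of_nonneg_right h1 (hd i).le]

/-- If the scaled values at two neighbours bound each other through the row ratios, they
vanish. -/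
theorem eq_zero_of_le_of_le (hd : ∀ i, 0 < d i) (hA : WeaklyScaledDiagDominant A d)
    {i v : Fin n} (hadj : (inducedGraph A).Adj i v) {e f : ℝ}
    (h1 : |e| / d i ≤ rowRatio A d i * (|f| / d v))
    (h2 : |f| / d v ≤ rowRatio A d v * (|e| / d i)) : e = 0 := by
  have h3 := h1.trans (mul_le_mul_of_nonneg_left h2 (rowRatio_nonneg hd hA i))
  have h4 := hA.2 i v hadj
  by_contra he
  have h5 : 0 < |e| / d i := div_pos (abs_pos.2 he) (hd i)
  nlinarith

/-- At the largest scaled entry of a kernel vector, two row estimates lead to a neighbour and back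
to the maximum, with factor `ϱ_i ϱ_v < 1`. -/
theorem isUnit_det (hd : ∀ i, 0 < d i) (hA : WeaklyScaledDiagDominant A d) : IsUnit A.det := by
  rw [isUnit_iff_ne_zero]
  intro hdet
  obtain ⟨x, hx0, hx⟩ := Matrix.exists_mulVec_eq_zero_iff.2 hdet
  obtain ⟨i₀, hi₀⟩ := Function.ne_iff.1 hx0
  obtain ⟨i, -, hmax⟩ := Finset.exists_max_image Finset.univ (fun v => |x v| / d v)
    ⟨i₀, Finset.mem_univ _⟩
  have hrow : ∀ i, A i i * x i + ∑ v ∈ nbr A i, A i v * x v = 0 := fun i => by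
    rw [← mulVec_eq_sum_nbr, hx, Pi.zero_apply]
  have hxi : x i = 0 := by
    rcases (nbr A i).eq_empty_or_nonempty with he | hne
    · simpa [he, (hA.1 i).ne'] using hrow i
    · obtain ⟨v, hv, h1⟩ := exists_nbr_le hd (hA.1 i) hne (hrow i)
      have hadj := mem_nbr.1 hv
      obtain ⟨u, -, h2⟩ := exists_nbr_le hd (hA.1 v) ⟨i, mem_nbr.2 hadj.symm⟩ (hrow v)
      exact eq_zero_of_le_of_le hd hA hadj h1 (h2.trans (mul_le_mul_of_nonneg_left
        (hmax u (Finset.mem_univ u)) (rowRatio_nonneg hd hA v)))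
  have := hmax i₀ (Finset.mem_univ _)
  rw [hxi, abs_zero, zero_div] at this
  exact absurd (div_pos (abs_pos.2 hi₀) (hd i₀)) (not_lt.2 this)

/-- A weakly scaled diagonally dominant matrix is strictly diagonally dominant in another
scaling. -/
theorem exists_strict_scaling (hd : ∀ i, 0 < d i) (hA : WeaklyScaledDiagDominant A d) :
    ∃ d' : Fin n → ℝ, (∀ i, 0 < d' i) ∧ ∀ i, ∑ v ∈ nbr A i, |A i v| * d' v < A i i * d' i := by
  have hρ := rowRatio_nonneg hd hA
  obtain ⟨ε, hε0, hε⟩ : ∃ ε : ℝ, 0 < ε ∧ ∀ i v, (inducedGraph A).Adj i v →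
      rowRatio A d i * (rowRatio A d v + ε) < 1 := by
    have hev : ∀ᶠ ε in nhdsWithin (0 : ℝ) (Set.Ioi 0), ∀ i v, (inducedGraph A).Adj i v →
        rowRatio A d i * (rowRatio A d v + ε) < 1 := by
      refine Filter.eventually_all.2 fun i => Filter.eventually_all.2 fun v => ?_
      by_cases hadj : (inducedGraph A).Adj i v
      · have hc : Continuous fun ε : ℝ => rowRatio A d i * (rowRatio A d v + ε) := by fun_prop
        have := (hc.tendsto 0).eventually_lt_const (u := 1) (by simpa using hA.2 i v hadj)
        filter_upwards [nhdsWithin_le_nhds this] with ε h _ using h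
      · exact Filter.Eventually.of_forall fun ε h => absurd h hadj
    obtain ⟨ε, h, hε⟩ := (hev.and self_mem_nhdsWithin).exists
    exact ⟨ε, hε, h⟩
  -- The goal is `ϱ_i * s v < s i` on edges. If `ϱ_v ≥ 1`, the left side is below `1 ≤ s i` by the
  -- choice of `ε`; otherwise `s v = 1` and `ϱ_i < s i`.
  set s : Fin n → ℝ := fun i => if 1 ≤ rowRatio A d i then rowRatio A d i + ε else 1 with hs
  have hs0 : ∀ i, 0 < s i := fun i => by
    simp only [hs]
    split_ifs <;> linarith [hρ i]
  have hlt : ∀ i v, (inducedGraph A).Adj i v → rowRatio A d i * s v < s i := fun i v hadj => by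
    have h1 := hε i v hadj
    have h2 := hA.2 i v hadj
    simp only [hs]
    split_ifs with hv hi hi
    · nlinarith
    · linarith
    · linarith
    · linarith
  refine ⟨fun i => d i * s i, fun i => mul_pos (hd i) (hs0 i), fun i => ?_⟩
  rcases (nbr A i).eq_empty_or_nonempty with he | hne
  · simpa [he] using mul_pos (hA.1 i) (mul_pos (hd i) (hs0 i))
  obtain ⟨v, hv, hmax⟩ := Finset.exists_max_image (nbr A i) s hne
  have hT : 0 < A i i * d i := mul_pos (hA.1 i) (hd i)
  calc ∑ u ∈ nbr A i, |A i u| * (d u * s u)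
      ≤ ∑ u ∈ nbr A i, |A i u| * d u * s v := by
        refine Finset.sum_le_sum fun u hu => ?_
        rw [← mul_assoc]
        exact mul_le_mul_of_nonneg_left (hmax u hu) (mul_nonneg (abs_nonneg _) (hd u).le)
    _ = rowRatio A d i * s v * (A i i * d i) := by
        rw [← Finset.sum_mul, rowRatio_eq, mul_right_comm, div_mul_cancel₀ _ hT.ne']
    _ < s i * (A i i * d i) := mul_lt_mul_of_pos_right (hlt i v (mem_nbr.1 hv)) hT
    _ = A i i * (d i * s i) := by ring

end Rows

/-! ### The messages stay positive -/

section Messages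

variable {n : ℕ} {A : Matrix (Fin n) (Fin n) ℝ}

theorem sub_sum_nbr_add {i j : Fin n} (hj : j ∈ nbr A i) (f : Fin n → ℝ) (c : ℝ) :
    c - ∑ v ∈ nbr A i, f v + f j = c - ∑ v ∈ (nbr A i).erase j, f v := by
  rw [← Finset.add_sum_erase _ _ hj]
  ring

/-- The added term cancels the recipient's own contribution; excluding `j` here is what makes the
error walks non-reversal. -/
theorem msgA_succ {i j : Fin n} (hj : j ∈ nbr A i) (k : ℕ) :
    msgA A (k + 1) i j = A i i - ∑ v ∈ (nbr A i).erase j, A v i * A i v / msgA A k v i :=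
  sub_sum_nbr_add hj (fun v => A v i * A i v / msgA A k v i) (A i i)

theorem msgB_succ {i j : Fin n} (hj : j ∈ nbr A i) (b : Fin n → ℝ) (k : ℕ) :
    msgB A b (k + 1) i j =
      b i - ∑ v ∈ (nbr A i).erase j, A i v * msgB A b k v i / msgA A k v i :=
  sub_sum_nbr_add hj (fun v => A i v * msgB A b k v i / msgA A k v i) (b i)

/-- The Schur complement bound behind one step of the algorithm. -/
theorem sum_div_le {d : Fin n → ℝ} (hd : ∀ i, 0 < d i) {i : Fin n} {S : Finset (Fin n)}
    {μ : Fin n → ℝ} (hμ : ∀ v ∈ S, |A v i| * d i < μ v * d v) :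
    (∑ v ∈ S, A v i * A i v / μ v) * d i ≤ ∑ v ∈ S, |A i v| * d v := by
  rw [Finset.sum_mul]
  refine Finset.sum_le_sum fun v hv => ?_
  have h := hμ v hv
  have hpos : 0 < μ v := by
    have : 0 < μ v * d v := (mul_nonneg (abs_nonneg _) (hd i).le).trans_lt h
    exact pos_of_mul_pos_left this (hd v).le
  rw [div_mul_eq_mul_div, div_le_iff₀ hpos]
  calc A v i * A i v * d i ≤ |A v i * A i v| * d i :=
        mul_le_mul_of_nonneg_right (le_abs_self _) (hd i).le
    _ = |A i v| * (|A v i| * d i) := by rw [abs_mul]; ring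
    _ ≤ |A i v| * (μ v * d v) := mul_le_mul_of_nonneg_left h.le (abs_nonneg _)
    _ = |A i v| * d v * μ v := by ring

/-- Eliminating the neighbours other than `j` uses up at most their share of row `i`; strict
dominance leaves more than the share of `j`. -/
theorem msgA_bound {d : Fin n → ℝ} (hd : ∀ i, 0 < d i)
    (hA : ∀ i, ∑ v ∈ nbr A i, |A i v| * d v < A i i * d i) (k : ℕ) :
    ∀ i, ∀ j ∈ nbr A i, |A i j| * d j < msgA A k i j * d i := by
  induction k with
  | zero =>
    intro i j hj
    exact (Finset.single_le_sum (f := fun v => |A i v| * d v)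
      (fun v _ => mul_nonneg (abs_nonneg _) (hd v).le) hj).trans_lt (hA i)
  | succ k ih =>
    intro i j hj
    have h := sum_div_le hd (S := (nbr A i).erase j) (μ := fun v => msgA A k v i) fun v hv =>
      ih v i (mem_nbr.2 (mem_nbr.1 (Finset.mem_of_mem_erase hv)).symm)
    have h2 := hA i
    rw [← Finset.add_sum_erase _ _ hj] at h2
    rw [msgA_succ hj, sub_mul]
    linarith

theorem msgA_pos {d : Fin n → ℝ} (hd : ∀ i, 0 < d i) (hA : WeaklyScaledDiagDominant A d)
    (k : ℕ) {i j : Fin n} (h : (inducedGraph A).Adj i j) : 0 < msgA A k i j := by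
  obtain ⟨d', hd', hA'⟩ := exists_strict_scaling hd hA
  exact pos_of_mul_pos_left ((mul_nonneg (abs_nonneg _) (hd' j).le).trans_lt
    (msgA_bound hd' hA' k i j (mem_nbr.2 h))) (hd' i).le

theorem nodeAStep_pos {d : Fin n → ℝ} (hd : ∀ i, 0 < d i) (hA : WeaklyScaledDiagDominant A d)
    (k : ℕ) (i : Fin n) : 0 < nodeAStep A (msgA A k) i := by
  obtain ⟨d', hd', hA'⟩ := exists_strict_scaling hd hA
  refine pos_of_mul_pos_left (b := d' i) ?_ (hd' i).le
  have h := sum_div_le hd' (S := nbr A i) (μ := fun v => msgA A k v i) fun v hv =>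
    msgA_bound hd' hA' k v i (mem_nbr.2 (mem_nbr.1 hv).symm)
  rw [nodeAStep, sub_mul]
  linarith [hA' i]

theorem algorithmWellDefined {d : Fin n → ℝ} (hd : ∀ i, 0 < d i)
    (hA : WeaklyScaledDiagDominant A d) : AlgorithmWellDefined A :=
  ⟨fun k _ _ h => (msgA_pos hd hA k h).ne', fun k i => (nodeAStep_pos hd hA k i).ne'⟩

end Messages

/-! ### The error of the estimates -/

section Error

variable {n : ℕ} {A : Matrix (Fin n) (Fin n) ℝ} {d : Fin n → ℝ}

/-- Back substitution: the values `(β v - A v i * e) / μ v` at the nodes `v ∈ S`, together with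
`e` at `i`, solve the eliminated row equation at `i`, up to the solution `x`. -/
theorem back_substitution {i : Fin n} {S : Finset (Fin n)} {b e : ℝ} {x μ β : Fin n → ℝ}
    (hμ : ∀ v ∈ S, μ v ≠ 0) :
    A i i * e + ∑ v ∈ S, A i v * ((β v - A v i * (x i + e)) / μ v - x v) =
      (A i i - ∑ v ∈ S, A v i * A i v / μ v) * (x i + e) -
        (b - ∑ v ∈ S, A i v * β v / μ v) + (b - A i i * x i - ∑ v ∈ S, A i v * x v) := by
  have : ∑ v ∈ S, A i v * ((β v - A v i * (x i + e)) / μ v - x v) =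
      ∑ v ∈ S, A i v * β v / μ v - (∑ v ∈ S, A v i * A i v / μ v) * (x i + e) -
        ∑ v ∈ S, A i v * x v := by
    rw [Finset.sum_mul, ← Finset.sum_sub_distrib, ← Finset.sum_sub_distrib]
    refine Finset.sum_congr rfl fun v hv => ?_
    have := hμ v hv
    field_simp
  rw [this]
  ring

/-- The error `e` at node `i`, as a function of the error `y` at `j`, after `m` iterations in the
part of the computation tree that hangs on the edge from `j` to `i`. -/
theorem message_error_le (hd : ∀ i, 0 < d i) (hA : WeaklyScaledDiagDominant A d)
    {b x : Fin n → ℝ} (hx : A.mulVec x = b) {B : ℝ} (hB : ∀ v, |x v| / d v ≤ B) (m : ℕ) :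
    ∀ i j, (inducedGraph A).Adj i j → ∀ e y,
      msgA A m i j * (x i + e) + A i j * (x j + y) = msgB A b m i j →
      |e| / d i ≤ rowRatio A d i * (|y| / d j) ∨
      ∃ w : ℕ → Fin n, IsNonrevSeq (inducedGraph A) w (m + 1) ∧ w 0 = j ∧ w 1 = i ∧
        |e| / d i ≤ (∏ l ∈ Finset.range (m + 1), rowRatio A d (w (l + 1))) * B := by
  have hρ := rowRatio_nonneg hd hA
  have hrow : ∀ i, ∀ j ∈ nbr A i, b i - A i i * x i - ∑ v ∈ (nbr A i).erase j, A i v * x v =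
      A i j * x j := fun i j hj => by
    rw [← hx, mulVec_eq_sum_nbr, ← Finset.add_sum_erase _ _ hj]
    ring
  -- the row equation with the error `y` at `j` and the errors `f` at the other neighbours
  have key : ∀ i j, (inducedGraph A).Adj i j → ∀ (e y : ℝ) (f : Fin n → ℝ),
      A i i * e + ∑ v ∈ (nbr A i).erase j, A i v * f v + A i j * y = 0 →
      |e| / d i ≤ rowRatio A d i * (|y| / d j) ∨
      ∃ v ∈ nbr A i, v ≠ j ∧ |e| / d i ≤ rowRatio A d i * (|f v| / d v) := by
    intro i j hij e y f h
    have hj := mem_nbr.2 hij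
    obtain ⟨v, hv, hle⟩ := exists_nbr_le hd (hA.1 i) ⟨j, hj⟩ (e := e)
      (f := fun v => if v = j then y else f v) (by
        rw [← Finset.add_sum_erase _ _ hj, if_pos rfl, Finset.sum_congr rfl fun v hv => by
          rw [if_neg (Finset.ne_of_mem_erase hv)]]
        linarith)
    by_cases hvj : v = j
    · subst hvj
      exact Or.inl (by simpa using hle)
    · exact Or.inr ⟨v, hv, hvj, by simpa [hvj] using hle⟩
  induction m with
  | zero =>
    intro i j hij e y h
    have hj := mem_nbr.2 hij
    -- The initial message ignores the other neighbours, that is, gives them value `0` and error `-x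
    -- v`.
    rcases key i j hij e y (fun v => -x v) (by
      have := hrow i j hj
      simp only [msgA, msgB] at h
      simp only [mul_neg, Finset.sum_neg_distrib]
      linarith) with h1 | ⟨v, -, -, h1⟩
    · exact Or.inl h1
    · refine Or.inr ⟨fun l => if l = 0 then j else i, ⟨fun l hl => ?_, fun l hl => by omega⟩,
        by simp, by simp, ?_⟩
      · obtain rfl : l = 0 := by omega
        simpa using hij.symm
      · rw [abs_neg] at h1
        simpa using h1.trans (mul_le_mul_of_nonneg_left (hB v) (hρ i))
  | succ m ih =>
    intro i j hij e y h
    have hj := mem_nbr.2 hij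
    have hμ : ∀ v ∈ (nbr A i).erase j, msgA A m v i ≠ 0 := fun v hv =>
      (msgA_pos hd hA m (mem_nbr.1 (Finset.mem_of_mem_erase hv)).symm).ne'
    set f : Fin n → ℝ := fun v => (msgB A b m v i - A v i * (x i + e)) / msgA A m v i - x v with hf
    rcases key i j hij e y f (by
      have h1 := back_substitution (A := A) (i := i) (b := b i) (e := e) (x := x)
          (β := fun v => msgB A b m v i) hμ
      rw [← msgA_succ hj, ← msgB_succ hj, hrow i j hj] at h1
      rw [hf, h1]
      linarith) with h1 | ⟨v, hv, hvj, h1⟩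
    · exact Or.inl h1
    · have hiv := mem_nbr.1 hv
      have hfv : msgA A m v i * (x v + f v) + A v i * (x i + e) = msgB A b m v i := by
        have := (msgA_pos hd hA m hiv.symm).ne'
        simp only [hf]
        field_simp
        ring
      -- Either the bound on `f v` turns back to `i` and kills `e`, or `j` is prepended to the walk,
      -- with `v ≠ j` excluding a reversal.
      rcases ih v i hiv.symm (f v) e hfv with h2 | ⟨w, ⟨hadj, hrev⟩, hw0, hw1, h2⟩
      · left
        rw [eq_zero_of_le_of_le hd hA hiv h1 h2, abs_zero, zero_div]
        exact mul_nonneg (hρ i) (div_nonneg (abs_nonneg _) (hd j).le)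
      · refine Or.inr ⟨fun l => Nat.casesOn l j w, ⟨fun l hl => ?_, fun l hl => ?_⟩, rfl, hw0, ?_⟩
        · cases l with
          | zero => simpa [hw0] using hij.symm
          | succ l => exact hadj l (by omega)
        · cases l with
          | zero => simpa [hw1] using hvj
          | succ l => exact hrev l (by omega)
        · refine (h1.trans (mul_le_mul_of_nonneg_left h2 (hρ i))).trans (le_of_eq ?_)
          rw [Finset.prod_range_succ' _ (m + 1)]
          simp only [hw0]
          ring

/-- The error of an estimate is bounded by the gain of a non-reversal walk. -/
theorem estimate_error_le (hd : ∀ i, 0 < d i) (hA : WeaklyScaledDiagDominant A d)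
    {b x : Fin n → ℝ} (hx : A.mulVec x = b) {B : ℝ} (hB : ∀ v, |x v| / d v ≤ B) (k : ℕ)
    (i : Fin n) :
    estimate A b (k + 1) i - x i = 0 ∨
    ∃ w : ℕ → Fin n, IsNonrevSeq (inducedGraph A) w (k + 1) ∧
      |estimate A b (k + 1) i - x i| / d i ≤
        (∏ l ∈ Finset.range (k + 2), rowRatio A d (w l)) * B := by
  have hρ := rowRatio_nonneg hd hA
  set e := estimate A b (k + 1) i - x i with he
  have hμ : ∀ v ∈ nbr A i, msgA A k v i ≠ 0 := fun v hv =>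
    (msgA_pos hd hA k (mem_nbr.1 hv).symm).ne'
  have hnode : nodeAStep A (msgA A k) i * (x i + e) = nodeBStep A b (msgA A k) (msgB A b k) i := by
    rw [he, add_sub_cancel, estimate, mul_div_cancel₀ _ (nodeAStep_pos hd hA k i).ne']
  set f : Fin n → ℝ := fun v => (msgB A b k v i - A v i * (x i + e)) / msgA A k v i - x v with hf
  have hrow : A i i * e + ∑ v ∈ nbr A i, A i v * f v = 0 := by
    have h1 := back_substitution (A := A) (i := i) (b := b i) (e := e) (x := x)
        (β := fun v => msgB A b k v i) hμ
    have h2 : b i - A i i * x i - ∑ v ∈ nbr A i, A i v * x v = 0 := by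
      rw [← hx, mulVec_eq_sum_nbr]
      ring
    rw [h2] at h1
    simp only [nodeAStep, nodeBStep] at hnode
    rw [hf, h1, hnode]
    ring
  rcases (nbr A i).eq_empty_or_nonempty with hemp | hne
  · left
    simpa [hemp, (hA.1 i).ne'] using hrow
  obtain ⟨v, hv, h1⟩ := exists_nbr_le hd (hA.1 i) hne hrow
  have hiv := mem_nbr.1 hv
  have hfv : msgA A k v i * (x v + f v) + A v i * (x i + e) = msgB A b k v i := by
    have := (msgA_pos hd hA k hiv.symm).ne'
    simp only [hf]
    field_simp
    ring
  rcases message_error_le hd hA hx hB k v i hiv.symm (f v) e hfv with h2 | ⟨w, hw, hw0, -, h2⟩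
  · exact Or.inl (eq_zero_of_le_of_le hd hA hiv h1 h2)
  · refine Or.inr ⟨w, hw, (h1.trans (mul_le_mul_of_nonneg_left h2 (hρ i))).trans (le_of_eq ?_)⟩
    rw [Finset.prod_range_succ' _ (k + 1), hw0]
    ring

/-- The estimates converge geometrically with every ratio above the maximum loop gain. -/
theorem exists_estimate_error_le_pow (hd : ∀ i, 0 < d i) (hA : WeaklyScaledDiagDominant A d)
    {b x : Fin n → ℝ} (hx : A.mulVec x = b) {r : ℝ} (hr0 : 0 < r) (hr : maxLoopGain A d ≤ r) :
    ∃ K : ℝ, ∀ k i, |estimate A b (k + 1) i - x i| ≤ K * r ^ (k + 1) := by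
  have hρ := rowRatio_nonneg hd hA
  set B := ∑ v, |x v| / d v
  have hB0 : ∀ v, 0 ≤ |x v| / d v := fun v => div_nonneg (abs_nonneg _) (hd v).le
  have hB : ∀ v, |x v| / d v ≤ B := fun v =>
    Finset.single_le_sum (fun v _ => hB0 v) (Finset.mem_univ v)
  have hBnn : 0 ≤ B := Finset.sum_nonneg fun v _ => hB0 v
  -- Chosen so that `1 ≤ M` and every ratio is at most `M * r`.
  set M := 1 + ∑ v, rowRatio A d v / r
  have hρr : ∀ v, 0 ≤ rowRatio A d v / r := fun v => div_nonneg (hρ v) hr0.le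
  have hM : 1 ≤ M := le_add_of_nonneg_right (Finset.sum_nonneg fun v _ => hρr v)
  have hM0 : 0 < M := by linarith
  have hρM : ∀ v, rowRatio A d v ≤ M * r := fun v => by
    rw [← div_le_iff₀ hr0]
    linarith [Finset.single_le_sum (fun v _ => hρr v) (Finset.mem_univ v)]
  have hd1 : ∀ i, d i ≤ ∑ i, d i := fun i =>
    Finset.single_le_sum (fun v _ => (hd v).le) (Finset.mem_univ i)
  have hdnn : 0 ≤ ∑ i, d i := Finset.sum_nonneg fun v _ => (hd v).le
  refine ⟨M ^ (Finset.univ : Finset (Fin n)).card * r * B * ∑ i, d i, fun k i => ?_⟩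
  rcases estimate_error_le hd hA hx hB k i with h | ⟨w, hw, h⟩
  · rw [h, abs_zero]
    positivity
  · have hg := nonrev_gain_le hρ hr0.le hM hρM (fun w k hw => (hw.gain_le_pow_maxLoopGain hρ).trans
      (pow_le_pow_left₀ (maxLoopGain_nonneg hρ) hr k)) Finset.univ w (k + 1) hw
      fun l _ => Finset.mem_univ _
    calc |estimate A b (k + 1) i - x i|
        ≤ (∏ l ∈ Finset.range (k + 2), rowRatio A d (w l)) * B * d i := (div_le_iff₀ (hd i)).1 h
      _ ≤ M ^ (Finset.univ : Finset (Fin n)).card * r ^ (k + 1 + 1) * B * ∑ i, d i :=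
          mul_le_mul (mul_le_mul_of_nonneg_right hg hBnn) (hd1 i) (hd i).le (by positivity)
      _ = _ := by ring

theorem seminorm_le_sum_abs (N : Seminorm ℝ (Fin n → ℝ)) (x : Fin n → ℝ) :
    N x ≤ ∑ i, |x i| * N (Pi.single i 1) := by
  conv_lhs => rw [pi_eq_sum_univ' x]
  refine (Finset.le_sum_of_subadditive N (map_zero N).le (map_add_le_add N) _ _).trans
    (Finset.sum_le_sum fun i _ => ?_)
  rw [map_smul_eq_mul, Real.norm_eq_abs]

theorem tendsto_estimate_error (hd : ∀ i, 0 < d i) (hA : WeaklyScaledDiagDominant A d)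
    {b x : Fin n → ℝ} (hx : A.mulVec x = b) (N : Seminorm ℝ (Fin n → ℝ)) {r : ℝ}
    (hr : maxLoopGain A d < r) :
    Filter.Tendsto (fun k : ℕ => N (estimate A b k - x) / r ^ k) Filter.atTop (nhds 0) := by
  have hρ := rowRatio_nonneg hd hA
  -- The error is `O(q ^ k)`; the gap `q < r` makes the limit `0`, and `q > 0` even if there are no
  -- loops.
  obtain ⟨q, hq, hqr⟩ := exists_between hr
  have hq0 : 0 < q := (maxLoopGain_nonneg hρ).trans_lt hq
  have hr0 : 0 < r := hq0.trans hqr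
  obtain ⟨K, hK⟩ := exists_estimate_error_le_pow hd hA hx hq0 hq.le
  have hlim : Filter.Tendsto (fun k : ℕ => (K * ∑ i, N (Pi.single i 1)) * (q / r) ^ k)
      Filter.atTop (nhds 0) := by
    simpa using (tendsto_pow_atTop_nhds_zero_of_lt_one (div_pos hq0 hr0).le
      ((div_lt_one hr0).2 hqr)).const_mul (K * ∑ i, N (Pi.single i 1))
  refine squeeze_zero' (Filter.Eventually.of_forall fun k => div_nonneg (apply_nonneg N _)
    (pow_nonneg hr0.le _)) ?_ hlim
  filter_upwards [Filter.eventually_ge_atTop 1] with k hk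
  obtain ⟨k, rfl⟩ := Nat.exists_eq_add_of_le' hk
  rw [div_pow, mul_div_assoc']
  refine div_le_div_of_nonneg_right ((seminorm_le_sum_abs N _).trans ?_) (pow_nonneg hr0.le _)
  calc ∑ i, |(estimate A b (k + 1) - x) i| * N (Pi.single i 1)
      ≤ ∑ i, K * q ^ (k + 1) * N (Pi.single i 1) := Finset.sum_le_sum fun i _ =>
        mul_le_mul_of_nonneg_right (hK k i) (apply_nonneg N _)
    _ = _ := by rw [← Finset.mul_sum]; ring

theorem asymptoticRate_le_maxLoopGain (hd : ∀ i, 0 < d i) (hA : WeaklyScaledDiagDominant A d)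
    (b : Fin n → ℝ) (N : Seminorm ℝ (Fin n → ℝ)) {C : ℝ} (hC : 0 ≤ C) :
    asymptoticRate A b N C ≤ (maxLoopGain A d : EReal) := by
  have hx : A.mulVec (exactSolution A b) = b := by
    rw [exactSolution, Matrix.mulVec_mulVec, Matrix.mul_nonsing_inv _ (isUnit_det hd hA),
      Matrix.one_mulVec]
  -- Every real `r` above the maximum is admissible with limit `0`, which satisfies the bound by `C
  -- * N x⋆` trivially.
  refine EReal.le_of_forall_lt_iff_le.1 fun r hr => ?_
  have hr' : maxLoopGain A d < r := EReal.coe_lt_coe_iff.1 hr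
  exact sInf_le ⟨r, rfl, (maxLoopGain_nonneg (rowRatio_nonneg hd hA)).trans_lt hr', 0,
    tendsto_estimate_error hd hA hx N hr', mul_nonneg hC (apply_nonneg N _)⟩

end Error

theorem theorem2 {n : ℕ} (A : Matrix (Fin n) (Fin n) ℝ) (d : Fin n → ℝ) (hd : ∀ i, 0 < d i)
    (hA : WeaklyScaledDiagDominant A d) :
    IsUnit A.det ∧
    AlgorithmWellDefined A ∧
    ((loopGains A d).Nonempty → IsGreatest (loopGains A d) (maxLoopGain A d)) ∧
    (∀ (b : Fin n → ℝ) (N : Seminorm ℝ (Fin n → ℝ)), (∀ x, N x = 0 → x = 0) →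
      ∀ C : ℝ, 0 < C → asymptoticRate A b N C ≤ (maxLoopGain A d : EReal)) ∧
    maxLoopGain A d < 1 :=
  ⟨isUnit_det hd hA, algorithmWellDefined hd hA,
    loopGains_isGreatest (rowRatio_nonneg hd hA),
    fun b N _ _ hC => asymptoticRate_le_maxLoopGain hd hA b N hC.le,
    maxLoopGain_lt_one hd hA⟩
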